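/- **Theorem.** There is a real polynomial $p$ in two variables such that the following holds. Let $n\ge 0$ be an integer, let $f:2^{[n]}\to\mathbb{R}_{\ge 0}$ be a monotone submodular function, let $\varepsilon\in(0,1)$, and consider a partition constraint on $[n]=\{1,\dots,n\}$: a partition of $[n]$ into parts $P_1,\dots,P_m$ with capacities $k_1,\dots,k_m\in\mathbb{Z}_{\ge 0}$, where a set $S\subseteq[n]$ is *feasible* if $|S\cap P_j|\le k_j$ for every $j$. Let $r$ be the rank of the constraint, i.e., the maximum cardinality of a feasible subset of $[n]$. Both Alice and Bob know $n$, $f$, $\varepsilon$ and the constraint. Alice receives a set $A\subseteq[n]$ and Bob a set $B\subseteq[n]$, and they have to agree on a feasible set $C\subseteq A\cup B$ with $$f(C)\;\ge\;\Bigl(1-\frac1e-\varepsilon\Bigr)\cdot\max\{f(S) : S\subseteq A\cup B,\ S \text{ feasible}\}.$$ Then the $\varepsilon$-error private-coin randomized communication complexity of this problem is at most $$r\cdot p\bigl(\log n,\,1/\varepsilon\bigr)$$ (with the convention $\log 0=0$). That is, there is a two-party protocol in which each party sends bits depending only on its own input, its own private random bits and the bits exchanged so far; whose output $C$ is determined by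 the bits exchanged; which on all inputs and all random choices exchanges at most $r\cdot p(\log n,1/\varepsilon)$ bits; and which for every pair $(A,B)$ outputs such a set $C$ with probability at least $1-\varepsilon$ over the private random bits. -/

import Mathlib

/-! ### Two-party communication -/

/-- A deterministic two-party protocol tree. At an internal node the owner of the node sends one
bit, which depends on the owner's own input only (and on the node, that is, on the bits sent so
far); every leaf carries the output, which is hence determined by the transcript and known to both
parties. -/
inductive ProtocolTree (X Y Z : Type) : Type where
  | output (z : Z) : ProtocolTree X Y Z
  | alice (bit : X → Bool) (next : Bool → ProtocolTree X Y Z) : ProtocolTree X Y Z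
  | bob (bit : Y → Bool) (next : Bool → ProtocolTree X Y Z) : ProtocolTree X Y Z

namespace ProtocolTree

variable {X Y Z : Type}

/-- The output on Alice's input `x` and Bob's input `y`. -/
def run : ProtocolTree X Y Z → X → Y → Z
  | output z, _, _ => z
  | alice bit next, x, y => (next (bit x)).run x y
  | bob bit next, x, y => (next (bit y)).run x y

/-- The worst-case number of bits exchanged, i.e. the height of the tree. -/
def cost : ProtocolTree X Y Z → ℕ
  | output _ => 0
  | alice _ next => 1 + max (next false).cost (next true).cost
  | bob _ next => 1 + max (next false).cost (next true).cost

end ProtocolTree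

/-- A private-coin randomized protocol. Alice holds `coinsA` random bits and Bob `coinsB` random
bits; each bit sent depends on the sender's input, the sender's own random bits and the bits sent
so far. -/
structure PrivateCoinProtocol (X Y Z : Type) where
  coinsA : ℕ
  coinsB : ℕ
  tree : ProtocolTree (X × (Fin coinsA → Bool)) (Y × (Fin coinsB → Bool)) Z

namespace PrivateCoinProtocol

variable {X Y Z : Type}

/-- The worst-case number of bits exchanged, over all inputs and all coin tosses. -/
def cost (P : PrivateCoinProtocol X Y Z) : ℕ := P.tree.cost

open Classical in
/-- The probability, over independent uniformly random private bits of the two parties, that the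
output on inputs `x`, `y` satisfies `good`. -/
noncomputable def prob (P : PrivateCoinProtocol X Y Z) (x : X) (y : Y) (good : Z → Prop) : ℝ :=
  ((Finset.univ.filter fun ω : (Fin P.coinsA → Bool) × (Fin P.coinsB → Bool) =>
      good (P.tree.run (x, ω.1) (y, ω.2))).card : ℝ) /
    (Fintype.card ((Fin P.coinsA → Bool) × (Fin P.coinsB → Bool)) : ℝ)

/-- On every pair of inputs, the output is correct with probability at least `1 - δ`. -/
def Solves (P : PrivateCoinProtocol X Y Z) (correct : X → Y → Z → Prop) (δ : ℝ) : Prop :=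
  ∀ x y, 1 - δ ≤ P.prob x y (correct x y)

end PrivateCoinProtocol

/-- The `δ`-error private-coin randomized communication complexity of the search problem given by
the relation `correct`: the least cost of a private-coin protocol for it with error at most `δ`
(and `⊤` if there is none). -/
noncomputable def privateCoinComplexity {X Y Z : Type} (correct : X → Y → Z → Prop) (δ : ℝ) : ℕ∞ :=
  ⨅ (P : PrivateCoinProtocol X Y Z) (_ : P.Solves correct δ), (P.cost : ℕ∞)

/-! ### Submodular maximization under a partition constraint -/

/-- Submodularity of a set function on the subsets of `{0, …, n - 1}`. -/
def IsSubmodular {n : ℕ} (f : Finset (Fin n) → ℝ) : Prop :=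
  ∀ S T, f (S ∪ T) + f (S ∩ T) ≤ f S + f T

/-- A partition of the ground set with a capacity for each part (the values of `capacity` at sets
that are not parts play no role). -/
structure PartitionConstraint (n : ℕ) where
  partition : Finpartition (Finset.univ : Finset (Fin n))
  capacity : Finset (Fin n) → ℕ

namespace PartitionConstraint

variable {n : ℕ}

/-- A set is feasible (independent in the partition matroid) if it has at most `capacity P`
elements in every part `P`. -/
def Feasible (K : PartitionConstraint n) (S : Finset (Fin n)) : Prop :=
  ∀ P ∈ K.partition.parts, (S ∩ P).card ≤ K.capacity P

open Classical in
/-- The rank: the maximum cardinality of a feasible set. -/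
noncomputable def rank (K : PartitionConstraint n) : ℕ :=
  (Finset.univ.filter fun S : Finset (Fin n) => K.Feasible S).sup Finset.card

end PartitionConstraint

/-- `C` is an `α`-approximate solution on the ground set `A ∪ B`: it is a feasible subset of
`A ∪ B` whose value is at least `α` times that of every feasible subset of `A ∪ B`. -/
def IsApproxSolution {n : ℕ} (f : Finset (Fin n) → ℝ) (K : PartitionConstraint n) (α : ℝ)
    (A B C : Finset (Fin n)) : Prop :=
  C ⊆ A ∪ B ∧ K.Feasible C ∧ ∀ S, S ⊆ A ∪ B → K.Feasible S → α * f S ≤ f C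

/-!
The function `f` is known to both parties, so only the sets `A` and `B` cost communication, and the
protocol can be a local search whose current set is common knowledge. It needs no coins.

Plain local search for `f` only guarantees the factor `1 / 2`; it is therefore run on an auxiliary
potential. Let `F(p, S)` be the mean of `f` over a random subset of `S` that contains each element
with probability `p` (`sampleMean`), and `φ(S) = ∫ p in δ..1, exp (p - 1) / p * F(p, S)`
(`potential`). Adding `o` to `R` changes `F(p, R)` by `p` times the mean marginal value of `o`, and
the factor `p` cancels against the weight (`potential_insert_sub`). If no addition or swap
increases `φ(S)` by more than `κ`, then comparing gains and losses part by part
(`PartitionConstraint.Feasible.sum_gain_le`) gives, for every feasible `O`,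
`∫ exp (p - 1) * (f(O) - F(p, S)) ≤ ∫ exp (p - 1) * ∂F/∂p + |O| * κ`:
by submodularity the sum of the gains is at least the left side, and the sum of the losses is the
integral on the right because `∂F/∂p` is the sum of the partial derivatives of the multilinear
extension (`hasDerivAt_sampleMean`). As `exp (p - 1) * (F + ∂F/∂p)` is the derivative of
`exp (p - 1) * F`, this yields `(1 - exp (δ - 1)) * f(O) ≤ f(S) + |O| * κ`
(`PartitionConstraint.Feasible.le_of_locallyOptimal`). The cutoff `δ > 0` costs an additive `δ` in
the ratio and makes `φ ≤ f / δ`, so that `κ = c * φ(S)` with `c` of order `ε ^ 2 / r` is affordable.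

In each round Alice and then Bob announce a best move of theirs, if it improves `φ` by a factor of
more than `1 + c`. After one round from `∅` the potential is at least half that of the best feasible
singleton, and by subadditivity the potential of a feasible subset of `A ∪ B` is at most `1 + 4 * r`
times as large. So a local optimum is reached after `O(log (r + 1) / c)` rounds
(`localSearch_converges`), each of which costs `O(log n + 1)` bits. If `r = 0`, the empty set is the
only feasible set and is output without communication.
-/

/-! ### Means over random subsets -/

/-- The mean of `f` over the random subset of `S` that contains each element of `S`
independently with probability `p` (the multilinear extension of `f` at `p • 1_S`). -/
noncomputable def sampleMean {α : Type*} [DecidableEq α] (f : Finset α → ℝ) (S : Finset α)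
    (p : ℝ) : ℝ :=
  ∑ T ∈ S.powerset, p ^ T.card * (1 - p) ^ (S \ T).card * f T

/-- The marginal value of `a` as a function of the set to which it is added. -/
def marginal {α : Type*} [DecidableEq α] (f : Finset α → ℝ) (a : α) (T : Finset α) : ℝ :=
  f (insert a T) - f T

section SampleMean

variable {α : Type*} [DecidableEq α] {f g : Finset α → ℝ} {S : Finset α} {a : α} {p : ℝ}

theorem sampleMean_empty : sampleMean f ∅ p = f ∅ := by
  simp [sampleMean]

theorem sampleMean_insert (f : Finset α → ℝ) (ha : a ∉ S) (p : ℝ) :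
    sampleMean f (insert a S) p =
      (1 - p) * sampleMean f S p + p * sampleMean (fun T => f (insert a T)) S p := by
  unfold sampleMean
  rw [Finset.sum_powerset_insert ha, Finset.mul_sum, Finset.mul_sum]
  congr 1
  · refine Finset.sum_congr rfl fun T hT => ?_
    have haT : a ∉ T := fun h => ha (Finset.mem_powerset.1 hT h)
    rw [Finset.insert_sdiff_of_notMem _ haT,
      Finset.card_insert_of_notMem (fun h => ha (Finset.mem_sdiff.1 h).1)]
    ring
  · refine Finset.sum_congr rfl fun T hT => ?_
    have haT : a ∉ T := fun h => ha (Finset.mem_powerset.1 hT h)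
    rw [Finset.insert_sdiff_insert, Finset.sdiff_insert_of_notMem ha,
      Finset.card_insert_of_notMem haT]
    ring

theorem sampleMean_sub :
    sampleMean (fun T => f T - g T) S p = sampleMean f S p - sampleMean g S p := by
  simp only [sampleMean, mul_sub, Finset.sum_sub_distrib]

theorem sampleMean_sum {ι : Type*} (s : Finset ι) (h : ι → Finset α → ℝ) :
    sampleMean (fun T => ∑ i ∈ s, h i T) S p = ∑ i ∈ s, sampleMean (h i) S p := by
  simp only [sampleMean, Finset.mul_sum]
  exact Finset.sum_comm

theorem sampleMean_const (c : ℝ) : sampleMean (fun _ => c) S p = c := by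
  induction S using Finset.induction_on with
  | empty => exact sampleMean_empty
  | insert a S ha ih => rw [sampleMean_insert _ ha, ih]; ring

theorem sampleMean_one : sampleMean f S 1 = f S := by
  induction S using Finset.induction_on generalizing f with
  | empty => exact sampleMean_empty
  | insert a S ha ih => rw [sampleMean_insert _ ha, ih, ih]; ring

theorem sampleMean_mono (hp0 : 0 ≤ p) (hp1 : p ≤ 1) (hfg : ∀ T ⊆ S, f T ≤ g T) :
    sampleMean f S p ≤ sampleMean g S p := by
  refine Finset.sum_le_sum fun T hT => ?_
  have := hfg T (Finset.mem_powerset.1 hT)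
  have : 0 ≤ 1 - p := by linarith
  gcongr

theorem sampleMean_nonneg (hp0 : 0 ≤ p) (hp1 : p ≤ 1) (hf : ∀ T, 0 ≤ f T) :
    0 ≤ sampleMean f S p := by
  rw [← sampleMean_const (S := S) (p := p) 0]
  exact sampleMean_mono hp0 hp1 fun T _ => hf T

theorem sampleMean_anti_set (hp0 : 0 ≤ p) (hp1 : p ≤ 1) (hf : Antitone f) {R : Finset α}
    (hRS : R ⊆ S) : sampleMean f S p ≤ sampleMean f R p := by
  have key : ∀ U : Finset α, sampleMean f (U ∪ R) p ≤ sampleMean f R p := by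
    intro U
    induction U using Finset.induction_on with
    | empty => simp
    | insert a U _ ih =>
      rw [Finset.insert_union]
      by_cases ha : a ∈ U ∪ R
      · rwa [Finset.insert_eq_of_mem ha]
      · rw [sampleMean_insert _ ha]
        have : sampleMean (fun T => f (insert a T)) (U ∪ R) p ≤ sampleMean f (U ∪ R) p :=
          sampleMean_mono hp0 hp1 fun T _ => hf (Finset.subset_insert a T)
        nlinarith
  simpa [Finset.union_eq_left.2 hRS] using key S

theorem sampleMean_insert_sub (f : Finset α → ℝ) (ha : a ∉ S) (p : ℝ) :
    sampleMean f (insert a S) p - sampleMean f S p = p * sampleMean (marginal f a) S p := by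
  have : sampleMean (marginal f a) S p =
      sampleMean (fun T => f (insert a T)) S p - sampleMean f S p := sampleMean_sub
  rw [sampleMean_insert f ha, this]
  ring

/-- The derivative along `p` is the sum of the partial derivatives of the multilinear extension. -/
theorem hasDerivAt_sampleMean (f : Finset α → ℝ) (S : Finset α) (p : ℝ) :
    HasDerivAt (sampleMean f S) (∑ s ∈ S, sampleMean (marginal f s) (S.erase s) p) p := by
  induction S using Finset.induction_on generalizing f with
  | empty =>
    have : sampleMean f ∅ = fun _ => f ∅ := funext fun p => sampleMean_empty
    rw [this]
    simpa using hasDerivAt_const p (f ∅)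
  | insert a S ha ih =>
    have h1 : HasDerivAt (sampleMean f (insert a S)) _ p :=
      (((((hasDerivAt_id p).const_sub 1).mul (ih f)).add
        ((hasDerivAt_id p).mul (ih fun T => f (insert a T)))).congr_of_eventuallyEq
        (Filter.Eventually.of_forall fun q => sampleMean_insert f ha q))
    refine h1.congr_deriv ?_
    have h2 : ∀ s ∈ S, sampleMean (marginal f s) ((insert a S).erase s) p =
        (1 - p) * sampleMean (marginal f s) (S.erase s) p +
          p * sampleMean (marginal (fun T => f (insert a T)) s) (S.erase s) p := by
      intro s hs
      have hne : a ≠ s := fun h => ha (h ▸ hs)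
      rw [Finset.erase_insert_of_ne hne,
        sampleMean_insert _ (fun h => ha (Finset.mem_of_mem_erase h))]
      have : (fun T => marginal f s (insert a T)) = marginal (fun T => f (insert a T)) s := by
        funext T
        simp only [marginal, Finset.insert_comm]
      rw [this]
    have h3 : sampleMean (marginal f a) S p =
      sampleMean (fun T => f (insert a T)) S p - sampleMean f S p := sampleMean_sub
    rw [Finset.sum_insert ha, Finset.erase_insert ha, Finset.sum_congr rfl h2,
      Finset.sum_add_distrib, ← Finset.mul_sum, ← Finset.mul_sum, h3]
    simp only [id]
    ring

theorem continuous_sampleMean (f : Finset α → ℝ) (S : Finset α) : Continuous (sampleMean f S) := by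
  unfold sampleMean
  fun_prop

end SampleMean

/-! ### Marginal values of submodular functions -/

section Submodular

variable {n : ℕ} {f : Finset (Fin n) → ℝ}

theorem IsSubmodular.marginal_antitone (hf : IsSubmodular f) (hmono : Monotone f) (a : Fin n) :
    Antitone (marginal f a) := by
  intro T T' hT
  unfold marginal
  by_cases ha : a ∈ T'
  · rw [Finset.insert_eq_of_mem ha]
    have := hmono (Finset.subset_insert a T)
    linarith
  · have h := hf (insert a T) T'
    have h1 : insert a T ∪ T' = insert a T' := by
      rw [Finset.insert_union, Finset.union_eq_right.2 hT]
    have h2 : insert a T ∩ T' = T := by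
      rw [Finset.insert_inter_of_notMem ha, Finset.inter_eq_left.2 hT]
    rw [h1, h2] at h
    linarith

theorem marginal_nonneg (hmono : Monotone f) (a : Fin n) (T : Finset (Fin n)) :
    0 ≤ marginal f a T :=
  sub_nonneg.2 (hmono (Finset.subset_insert a T))

theorem IsSubmodular.union_sub_le_sum_marginal (hf : IsSubmodular f) (hmono : Monotone f)
    (T O : Finset (Fin n)) : f (T ∪ O) - f T ≤ ∑ o ∈ O, marginal f o T := by
  induction O using Finset.induction_on with
  | empty => simp
  | insert a O ha ih =>
    rw [Finset.sum_insert ha, Finset.union_insert]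
    have := hf.marginal_antitone hmono a (Finset.subset_union_left : T ⊆ T ∪ O)
    simp only [marginal] at this ih ⊢
    linarith

end Submodular

/-! ### The potential -/

/-- The potential of the local search: the integral of `sampleMean f S` over the probabilities
`p ∈ [δ, 1]` against the weight `exp (p - 1) / p`. The cutoff `δ` keeps the weight bounded. -/
noncomputable def potential {n : ℕ} (f : Finset (Fin n) → ℝ) (δ : ℝ) (S : Finset (Fin n)) : ℝ :=
  ∫ p in δ..1, Real.exp (p - 1) / p * sampleMean f S p

/-- The integral of `sampleMean f S` over `[δ, 1]` against the weight `exp (p - 1)`. -/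
noncomputable def expMean {n : ℕ} (f : Finset (Fin n) → ℝ) (δ : ℝ) (S : Finset (Fin n)) : ℝ :=
  ∫ p in δ..1, Real.exp (p - 1) * sampleMean f S p

section Potential

open intervalIntegral

variable {n : ℕ} {f g : Finset (Fin n) → ℝ} {δ : ℝ} {S R : Finset (Fin n)} {a : Fin n}

theorem potential_intervalIntegrable (hδ : 0 < δ) (hδ1 : δ ≤ 1) (f : Finset (Fin n) → ℝ)
    (S : Finset (Fin n)) : IntervalIntegrable
      (fun p => Real.exp (p - 1) / p * sampleMean f S p) MeasureTheory.volume δ 1 := by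
  refine ContinuousOn.intervalIntegrable ?_
  rw [Set.uIcc_of_le hδ1]
  refine ContinuousOn.mul (ContinuousOn.div (by fun_prop) (by fun_prop) fun p hp => ?_)
    (continuous_sampleMean f S).continuousOn
  exact (hδ.trans_le hp.1).ne'

theorem expMean_intervalIntegrable (f : Finset (Fin n) → ℝ) (S : Finset (Fin n)) (δ : ℝ) :
    IntervalIntegrable (fun p => Real.exp (p - 1) * sampleMean f S p)
      MeasureTheory.volume δ 1 := by
  have := continuous_sampleMean f S
  exact Continuous.intervalIntegrable (by fun_prop) _ _

theorem integral_exp_sub_one (δ : ℝ) :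
    ∫ p in δ..1, Real.exp (p - 1) = 1 - Real.exp (δ - 1) := by
  rw [intervalIntegral.integral_comp_sub_right (fun x => Real.exp x) 1, integral_exp]
  simp

theorem expMean_mono (hδ : 0 < δ) (hδ1 : δ ≤ 1) (hfg : ∀ T, f T ≤ g T) :
    expMean f δ S ≤ expMean g δ S := by
  refine integral_mono_on hδ1 (expMean_intervalIntegrable _ _ _)
    (expMean_intervalIntegrable _ _ _) fun p hp => ?_
  have := sampleMean_mono (S := S) (hδ.le.trans hp.1) hp.2 fun T _ => hfg T
  gcongr

theorem expMean_const (c : ℝ) : expMean (fun _ => c) δ S = (1 - Real.exp (δ - 1)) * c := by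
  simp only [expMean, sampleMean_const, intervalIntegral.integral_mul_const, integral_exp_sub_one]

theorem expMean_sub : expMean (fun T => f T - g T) δ S = expMean f δ S - expMean g δ S := by
  unfold expMean
  rw [← integral_sub (expMean_intervalIntegrable _ _ _) (expMean_intervalIntegrable _ _ _)]
  simp only [sampleMean_sub, mul_sub]

theorem expMean_sum {ι : Type*} (s : Finset ι) (h : ι → Finset (Fin n) → ℝ) :
    expMean (fun T => ∑ i ∈ s, h i T) δ S = ∑ i ∈ s, expMean (h i) δ S := by
  unfold expMean
  rw [← integral_finsetSum fun i _ => expMean_intervalIntegrable _ _ _]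
  simp only [sampleMean_sum, Finset.mul_sum]

theorem expMean_nonneg (hδ : 0 < δ) (hδ1 : δ ≤ 1) (hf : ∀ T, 0 ≤ f T) : 0 ≤ expMean f δ S := by
  refine integral_nonneg hδ1 fun p hp => ?_
  have := sampleMean_nonneg (S := S) (hδ.le.trans hp.1) hp.2 hf
  positivity

theorem expMean_anti_set (hδ : 0 < δ) (hδ1 : δ ≤ 1) (hf : Antitone f) (hRS : R ⊆ S) :
    expMean f δ S ≤ expMean f δ R := by
  refine integral_mono_on hδ1 (expMean_intervalIntegrable _ _ _)
    (expMean_intervalIntegrable _ _ _) fun p hp => ?_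
  have := sampleMean_anti_set (hδ.le.trans hp.1) hp.2 hf hRS
  gcongr

theorem potential_nonneg (hδ : 0 < δ) (hδ1 : δ ≤ 1) (hf : ∀ T, 0 ≤ f T) :
    0 ≤ potential f δ S := by
  refine integral_nonneg hδ1 fun p hp => ?_
  have := sampleMean_nonneg (S := S) (hδ.le.trans hp.1) hp.2 hf
  have := hδ.trans_le hp.1
  positivity

/-- The factor `1 / p` in the weight of the potential cancels the probability `p` that `a` is
sampled. -/
theorem potential_insert_sub (hδ : 0 < δ) (hδ1 : δ ≤ 1) (ha : a ∉ S) :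
    potential f δ (insert a S) - potential f δ S = expMean (marginal f a) δ S := by
  unfold potential expMean
  rw [← integral_sub (potential_intervalIntegrable hδ hδ1 _ _)
    (potential_intervalIntegrable hδ hδ1 _ _)]
  refine integral_congr fun p hp => ?_
  rw [Set.uIcc_of_le hδ1] at hp
  have hp0 : p ≠ 0 := (hδ.trans_le hp.1).ne'
  rw [← mul_sub, sampleMean_insert_sub f ha]
  field_simp

theorem potential_le (hδ : 0 < δ) (hδ1 : δ ≤ 1) (hf : ∀ T, 0 ≤ f T) (hmono : Monotone f) :
    potential f δ S ≤ f S / δ := by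
  have h : potential f δ S ≤ ∫ _ in δ..1, f S / δ := by
    refine integral_mono_on hδ1 (potential_intervalIntegrable hδ hδ1 _ _)
      intervalIntegrable_const fun p hp => ?_
    have hp0 := hδ.trans_le hp.1
    have h1 : sampleMean f S p ≤ f S := by
      refine (sampleMean_mono (g := fun _ => f S) hp0.le hp.2 fun T hT => hmono hT).trans_eq ?_
      exact sampleMean_const _
    have h2 : Real.exp (p - 1) ≤ 1 := Real.exp_le_one_iff.2 (by linarith [hp.2])
    have h3 : Real.exp (p - 1) / p ≤ 1 / δ := by
      have := hp.1
      gcongr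
    calc Real.exp (p - 1) / p * sampleMean f S p ≤ 1 / δ * f S := by
          have := sampleMean_nonneg (S := S) hp0.le hp.2 hf
          gcongr
      _ = f S / δ := by ring
  rw [intervalIntegral.integral_const, smul_eq_mul] at h
  have : 0 ≤ f S / δ := div_nonneg (hf S) hδ.le
  nlinarith

/-- Integrating the derivative of `exp (p - 1) * sampleMean f S p` over `[δ, 1]`. -/
theorem sum_expMean_add_expMean_le (hδ : 0 < δ) (hδ1 : δ ≤ 1) (hf : ∀ T, 0 ≤ f T) :
    ∑ s ∈ S, expMean (marginal f s) δ (S.erase s) + expMean f δ S ≤ f S := by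
  have hd : ∀ p ∈ Set.uIcc δ 1, HasDerivAt (fun p => Real.exp (p - 1) * sampleMean f S p)
      ((∑ s ∈ S, Real.exp (p - 1) * sampleMean (marginal f s) (S.erase s) p) +
        Real.exp (p - 1) * sampleMean f S p) p := by
    intro p _
    have h := (((hasDerivAt_id p).sub_const 1).exp).mul (hasDerivAt_sampleMean f S p)
    refine h.congr_deriv ?_
    rw [← Finset.mul_sum]
    simp only [id]
    ring
  have hi : IntervalIntegrable
      (fun p => ∑ s ∈ S, Real.exp (p - 1) * sampleMean (marginal f s) (S.erase s) p)
      MeasureTheory.volume δ 1 := by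
    refine Continuous.intervalIntegrable (continuous_finsetSum _ fun s _ => ?_) _ _
    have := continuous_sampleMean (marginal f s) (S.erase s)
    fun_prop
  have h := integral_eq_sub_of_hasDerivAt hd (hi.add (expMean_intervalIntegrable f S δ))
  rw [integral_add hi (expMean_intervalIntegrable f S δ),
    integral_finsetSum fun s _ => expMean_intervalIntegrable _ _ _, sampleMean_one] at h
  have h0 : 0 ≤ Real.exp (δ - 1) * sampleMean f S δ :=
    mul_nonneg (Real.exp_pos _).le (sampleMean_nonneg hδ.le hδ1 hf)
  simp only [sub_self, Real.exp_zero, one_mul] at h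
  unfold expMean
  linarith

end Potential

/-! ### Sets that are locally optimal for the potential -/

section LocalOptimum

variable {n : ℕ}

theorem PartitionConstraint.feasible_empty (K : PartitionConstraint n) : K.Feasible ∅ := by
  intro P _
  simp

theorem PartitionConstraint.Feasible.mono {K : PartitionConstraint n} {S T : Finset (Fin n)}
    (hT : K.Feasible T) (hST : S ⊆ T) : K.Feasible S := fun P hP =>
  (Finset.card_le_card (Finset.inter_subset_inter_right hST)).trans (hT P hP)

theorem PartitionConstraint.Feasible.card_le_rank {K : PartitionConstraint n}
    {S : Finset (Fin n)} (hS : K.Feasible S) : S.card ≤ K.rank := by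
  classical
  exact Finset.le_sup (f := Finset.card) (by simpa using hS)

theorem PartitionConstraint.rank_le (K : PartitionConstraint n) : K.rank ≤ n := by
  classical
  exact Finset.sup_le fun S _ => by simpa using S.card_le_univ

theorem PartitionConstraint.Feasible.insert_of_card_lt {K : PartitionConstraint n}
    {S P : Finset (Fin n)} {o : Fin n} (hS : K.Feasible S) (hP : P ∈ K.partition.parts)
    (ho : o ∈ P) (hlt : (S ∩ P).card < K.capacity P) : K.Feasible (insert o S) := by
  intro Q hQ
  by_cases hoQ : o ∈ Q
  · obtain rfl : P = Q := K.partition.eq_of_mem_parts hP hQ ho hoQ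
    rw [Finset.insert_inter_of_mem hoQ]
    exact (Finset.card_insert_le _ _).trans hlt
  · rw [Finset.insert_inter_of_notMem hoQ]
    exact hS Q hQ

theorem PartitionConstraint.Feasible.insert_erase {K : PartitionConstraint n}
    {S P : Finset (Fin n)} {o s : Fin n} (hS : K.Feasible S) (hP : P ∈ K.partition.parts)
    (ho : o ∈ P) (hs : s ∈ S) (hsP : s ∈ P) : K.Feasible (insert o (S.erase s)) := by
  intro Q hQ
  by_cases hoQ : o ∈ Q
  · obtain rfl : P = Q := K.partition.eq_of_mem_parts hP hQ ho hoQ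
    rw [Finset.insert_inter_of_mem hoQ, Finset.erase_inter]
    refine (Finset.card_insert_le _ _).trans ?_
    rw [Finset.card_erase_add_one (Finset.mem_inter.2 ⟨hs, hsP⟩)]
    exact hS P hP
  · rw [Finset.insert_inter_of_notMem hoQ]
    exact (hS.mono (Finset.erase_subset s S)) Q hQ

/-- If every admissible addition and every admissible swap gains at most `κ`, then the total gain
`∑ o ∈ O, a o` is paid for by the total loss `∑ s ∈ S, b s`. Within a part all pairs can be swapped,
so the gains in the part are compared with the smallest loss there, and no matching between `O` and
`S` has to be chosen. -/
theorem PartitionConstraint.Feasible.sum_gain_le {K : PartitionConstraint n}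
    {S O : Finset (Fin n)} (hS : K.Feasible S) (hO : K.Feasible O) {a b : Fin n → ℝ} {κ : ℝ}
    (hκ : 0 ≤ κ) (hb : ∀ s ∈ S, 0 ≤ b s) (hab : ∀ o ∈ S, a o ≤ b o)
    (hadd : ∀ o ∈ O, o ∉ S → K.Feasible (insert o S) → a o ≤ κ)
    (hswap : ∀ o ∈ O, o ∉ S → ∀ s ∈ S, K.Feasible (insert o (S.erase s)) → a o ≤ b s + κ) :
    ∑ o ∈ O, a o ≤ ∑ s ∈ S, b s + O.card * κ := by
  have hpart : ∀ P ∈ K.partition.parts,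
      ∑ o ∈ O ∩ P, a o ≤ ∑ s ∈ S ∩ P, b s + (O ∩ P).card * κ := by
    intro P hP
    have hnew : ∑ o ∈ (O ∩ P) \ (S ∩ P), a o ≤
        ∑ s ∈ (S ∩ P) \ (O ∩ P), b s + (O ∩ P).card * κ := by
      set Δ := (O ∩ P) \ (S ∩ P)
      have hΔ : ∀ o ∈ Δ, o ∈ O ∧ o ∈ P ∧ o ∉ S := by
        intro o ho
        simp only [Δ, Finset.mem_sdiff, Finset.mem_inter] at ho
        tauto
      have hcard : (Δ.card : ℝ) * κ ≤ (O ∩ P).card * κ := by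
        have : Δ.card ≤ (O ∩ P).card := Finset.card_le_card Finset.sdiff_subset
        gcongr
      have hb' : ∀ s ∈ (S ∩ P) \ (O ∩ P), 0 ≤ b s := fun s hs =>
        hb s (Finset.mem_inter.1 (Finset.mem_sdiff.1 hs).1).1
      by_cases hlt : (S ∩ P).card < K.capacity P
      · have h1 : ∑ o ∈ Δ, a o ≤ Δ.card • κ := Finset.sum_le_card_nsmul _ _ _ fun o ho =>
          hadd o (hΔ o ho).1 (hΔ o ho).2.2 (hS.insert_of_card_lt hP (hΔ o ho).2.1 hlt)
        have h2 := Finset.sum_nonneg hb'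
        rw [nsmul_eq_mul] at h1
        linarith
      · have hle : Δ.card ≤ ((S ∩ P) \ (O ∩ P)).card := by
          refine Finset.card_sdiff_le_card_sdiff_iff.2 ?_
          exact (hO P hP).trans (not_lt.1 hlt)
        rcases Δ.eq_empty_or_nonempty with h0 | hne
        · rw [h0, Finset.sum_empty]
          have := Finset.sum_nonneg hb'
          positivity
        · obtain ⟨s, hs, hmin⟩ := Finset.exists_min_image ((S ∩ P) \ (O ∩ P)) b
            (Finset.card_pos.1 (hne.card_pos.trans_le hle))
          have hsS := Finset.mem_inter.1 (Finset.mem_sdiff.1 hs).1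
          have h1 : ∑ o ∈ Δ, a o ≤ Δ.card • (b s + κ) :=
            Finset.sum_le_card_nsmul _ _ _ fun o ho =>
              hswap o (hΔ o ho).1 (hΔ o ho).2.2 s hsS.1
                (hS.insert_erase hP (hΔ o ho).2.1 hsS.1 hsS.2)
          have h2 := Finset.card_nsmul_le_sum _ b (b s) hmin
          have h3 : (Δ.card : ℝ) * b s ≤ ((S ∩ P) \ (O ∩ P)).card * b s := by
            have := hb' s hs
            gcongr
          rw [nsmul_eq_mul] at h1 h2
          linarith
    have h1 := Finset.sum_inter_add_sum_sdiff (O ∩ P) (S ∩ P) a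
    have h2 := Finset.sum_inter_add_sum_sdiff (S ∩ P) (O ∩ P) b
    rw [Finset.inter_comm (S ∩ P)] at h2
    have h3 : ∑ o ∈ O ∩ P ∩ (S ∩ P), a o ≤ ∑ o ∈ O ∩ P ∩ (S ∩ P), b o :=
      Finset.sum_le_sum fun o ho =>
        hab o (Finset.mem_inter.1 (Finset.mem_inter.1 ho).2).1
    linarith
  have hsplit : ∀ (T : Finset (Fin n)) (h : Fin n → ℝ),
      ∑ P ∈ K.partition.parts, ∑ o ∈ T ∩ P, h o = ∑ o ∈ T, h o := by
    intro T h
    rw [← Finset.sum_biUnion]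
    · have hU : (K.partition.parts.biUnion fun P => P) = Finset.univ := K.partition.biUnion_parts
      rw [← Finset.inter_biUnion, hU, Finset.inter_univ]
    · intro P hP Q hQ hPQ
      exact (K.partition.disjoint hP hQ hPQ).mono Finset.inter_subset_right
        Finset.inter_subset_right
  have := Finset.sum_le_sum hpart
  rw [Finset.sum_add_distrib, hsplit, hsplit, ← Finset.sum_mul] at this
  have hc : ∑ P ∈ K.partition.parts, ((O ∩ P).card : ℝ) = O.card := by
    have := hsplit O fun _ => 1
    simpa using this
  rwa [hc] at this

variable {f : Finset (Fin n) → ℝ} {δ : ℝ}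

/-- The value of a set that is locally optimal for the potential up to an additive `κ`: summing the
gains `expMean (marginal f o) δ S` over `O` gives at least
`(1 - exp (δ - 1)) * f O - expMean f δ S`, while the losses sum up to at most
`f S - expMean f δ S`. -/
theorem PartitionConstraint.Feasible.le_of_locallyOptimal {K : PartitionConstraint n}
    (hf : ∀ S, 0 ≤ f S) (hmono : Monotone f) (hsub : IsSubmodular f) (hδ : 0 < δ) (hδ1 : δ ≤ 1)
    {S O : Finset (Fin n)} (hS : K.Feasible S) (hO : K.Feasible O) {κ : ℝ} (hκ : 0 ≤ κ)
    (hadd : ∀ o ∈ O, K.Feasible (insert o S) →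
      potential f δ (insert o S) ≤ potential f δ S + κ)
    (hswap : ∀ o ∈ O, ∀ s ∈ S, K.Feasible (insert o (S.erase s)) →
      potential f δ (insert o (S.erase s)) ≤ potential f δ S + κ) :
    (1 - Real.exp (δ - 1)) * f O ≤ f S + O.card * κ := by
  have hanti := fun a => hsub.marginal_antitone hmono a
  have hloss : ∀ s ∈ S, potential f δ S - potential f δ (S.erase s) =
      expMean (marginal f s) δ (S.erase s) := by
    intro s hs
    rw [← potential_insert_sub hδ hδ1 (Finset.notMem_erase s S), Finset.insert_erase hs]
  have hgain : ∀ o ∉ S, ∀ R ⊆ S, expMean (marginal f o) δ S ≤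
      potential f δ (insert o R) - potential f δ R := by
    intro o ho R hR
    rw [potential_insert_sub hδ hδ1 fun h => ho (hR h)]
    exact expMean_anti_set hδ hδ1 (hanti o) hR
  have hsum := hS.sum_gain_le hO (a := fun o => expMean (marginal f o) δ S)
    (b := fun s => expMean (marginal f s) δ (S.erase s)) hκ
    (fun s _ => expMean_nonneg hδ hδ1 (marginal_nonneg hmono s))
    (fun o _ => expMean_anti_set hδ hδ1 (hanti o) (Finset.erase_subset o S))
    (fun o hoO hoS hfeas => by
      have h1 := hgain o hoS S subset_rfl
      have h2 := hadd o hoO hfeas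
      linarith)
    (fun o hoO hoS s hs hfeas => by
      have h1 := hgain o hoS (S.erase s) (Finset.erase_subset s S)
      have h2 := hswap o hoO s hs hfeas
      have h3 := hloss s hs
      linarith)
  have htotal : expMean (fun T => f O - f T) δ S ≤ ∑ o ∈ O, expMean (marginal f o) δ S := by
    rw [← expMean_sum]
    refine expMean_mono hδ hδ1 fun T => ?_
    have h1 := hsub.union_sub_le_sum_marginal hmono T O
    have h2 := hmono (Finset.subset_union_right : O ⊆ T ∪ O)
    linarith
  rw [expMean_sub (f := fun _ => f O) (g := f), expMean_const] at htotal
  have := sum_expMean_add_expMean_le (S := S) hδ hδ1 hf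
  linarith

theorem potential_le_sum_singleton (hf : ∀ S, 0 ≤ f S) (hmono : Monotone f)
    (hsub : IsSubmodular f) (hδ : 0 < δ) (hδ1 : δ ≤ 1) (S : Finset (Fin n)) :
    potential f δ S ≤ potential f δ ∅ + ∑ e ∈ S, potential f δ {e} := by
  induction S using Finset.induction_on with
  | empty => simp
  | insert a S ha ih =>
    have h1 := potential_insert_sub (f := f) hδ hδ1 ha
    have h2 := potential_insert_sub (f := f) hδ hδ1 (Finset.notMem_empty a)
    have h3 := expMean_anti_set hδ hδ1 (hsub.marginal_antitone hmono a) (Finset.empty_subset S)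
    have h4 : 0 ≤ potential f δ ∅ := potential_nonneg hδ hδ1 hf
    rw [Finset.sum_insert ha]
    rw [insert_empty_eq] at h2
    linarith

end LocalOptimum

/-! ### Deterministic protocols with multi-bit messages -/

namespace ProtocolTree

variable {X Y Z : Type}

/-- Alice sends a message of `k` bits, and the protocol continues according to it. -/
def aliceSend : (k : ℕ) → (X → Fin k → Bool) → ((Fin k → Bool) → ProtocolTree X Y Z) →
    ProtocolTree X Y Z
  | 0, _, next => next Fin.elim0
  | k + 1, msg, next => alice (fun x => msg x 0) fun b =>
      aliceSend k (fun x => Fin.tail (msg x)) fun v => next (Fin.cons b v)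

/-- Bob sends a message of `k` bits, and the protocol continues according to it. -/
def bobSend : (k : ℕ) → (Y → Fin k → Bool) → ((Fin k → Bool) → ProtocolTree X Y Z) →
    ProtocolTree X Y Z
  | 0, _, next => next Fin.elim0
  | k + 1, msg, next => bob (fun y => msg y 0) fun b =>
      bobSend k (fun y => Fin.tail (msg y)) fun v => next (Fin.cons b v)

theorem run_aliceSend (k : ℕ) (msg : X → Fin k → Bool)
    (next : (Fin k → Bool) → ProtocolTree X Y Z) (x : X) (y : Y) :
    (aliceSend k msg next).run x y = (next (msg x)).run x y := by
  induction k with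
  | zero => rw [aliceSend, Subsingleton.elim (msg x) Fin.elim0]
  | succ k ih => rw [aliceSend, run, ih, Fin.cons_self_tail]

theorem run_bobSend (k : ℕ) (msg : Y → Fin k → Bool)
    (next : (Fin k → Bool) → ProtocolTree X Y Z) (x : X) (y : Y) :
    (bobSend k msg next).run x y = (next (msg y)).run x y := by
  induction k with
  | zero => rw [bobSend, Subsingleton.elim (msg y) Fin.elim0]
  | succ k ih => rw [bobSend, run, ih, Fin.cons_self_tail]

theorem cost_aliceSend_le (k : ℕ) (msg : X → Fin k → Bool)
    (next : (Fin k → Bool) → ProtocolTree X Y Z) {c : ℕ} (hc : ∀ v, (next v).cost ≤ c) :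
    (aliceSend k msg next).cost ≤ k + c := by
  induction k with
  | zero => simpa [aliceSend] using hc _
  | succ k ih =>
    rw [aliceSend, cost]
    have := fun b => ih (fun x => Fin.tail (msg x)) (fun v => next (Fin.cons b v)) fun v => hc _
    have h0 := this false
    have h1 := this true
    omega

theorem cost_bobSend_le (k : ℕ) (msg : Y → Fin k → Bool)
    (next : (Fin k → Bool) → ProtocolTree X Y Z) {c : ℕ} (hc : ∀ v, (next v).cost ≤ c) :
    (bobSend k msg next).cost ≤ k + c := by
  induction k with
  | zero => simpa [bobSend] using hc _
  | succ k ih =>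
    rw [bobSend, cost]
    have := fun b => ih (fun x => Fin.tail (msg x)) (fun v => next (Fin.cons b v)) fun v => hc _
    have h0 := this false
    have h1 := this true
    omega

/-- The protocol that maintains a common state `σ` for a given number of rounds and outputs the last
one. In each round Alice and then Bob send a `k`-bit message that depends on their input and on the
current state, and the state is updated according to the message. -/
def alternate {k : ℕ} (msgA : Z → X → Fin k → Bool) (msgB : Z → Y → Fin k → Bool)
    (update : Z → (Fin k → Bool) → Z) : ℕ → Z → ProtocolTree X Y Z
  | 0, σ => output σ
  | t + 1, σ => aliceSend k (msgA σ) fun v => bobSend k (msgB (update σ v)) fun w =>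
      alternate msgA msgB update t (update (update σ v) w)

theorem run_alternate {k : ℕ} (msgA : Z → X → Fin k → Bool) (msgB : Z → Y → Fin k → Bool)
    (update : Z → (Fin k → Bool) → Z) (t : ℕ) (σ : Z) (x : X) (y : Y) :
    (alternate msgA msgB update t σ).run x y =
      (fun τ => update (update τ (msgA τ x)) (msgB (update τ (msgA τ x)) y))^[t] σ := by
  induction t generalizing σ with
  | zero => rfl
  | succ t ih => rw [alternate, run_aliceSend, run_bobSend, ih, Function.iterate_succ_apply]

theorem cost_alternate_le {k : ℕ} (msgA : Z → X → Fin k → Bool) (msgB : Z → Y → Fin k → Bool)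
    (update : Z → (Fin k → Bool) → Z) (t : ℕ) (σ : Z) :
    (alternate msgA msgB update t σ).cost ≤ t * (2 * k) := by
  induction t generalizing σ with
  | zero => simp [alternate, cost]
  | succ t ih =>
    have := cost_aliceSend_le k (msgA σ) (fun v => bobSend k (msgB (update σ v)) fun w =>
      alternate msgA msgB update t (update (update σ v) w))
      fun v => cost_bobSend_le k _ _ fun w => ih _
    rw [alternate]
    refine this.trans (le_of_eq ?_)
    ring

end ProtocolTree

/-- A deterministic protocol is a private-coin protocol without coins. -/
theorem privateCoinComplexity_le_of_deterministic {X Y Z : Type} {correct : X → Y → Z → Prop}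
    {δ : ℝ} (hδ : 0 ≤ δ)
    (tree : ProtocolTree (X × (Fin 0 → Bool)) (Y × (Fin 0 → Bool)) Z)
    (h : ∀ x y, correct x.1 y.1 (tree.run x y)) :
    privateCoinComplexity correct δ ≤ (tree.cost : ℕ∞) := by
  refine iInf₂_le (⟨0, 0, tree⟩ : PrivateCoinProtocol X Y Z) fun x y => ?_
  have hall : ∀ ω : (Fin 0 → Bool) × (Fin 0 → Bool),
      correct x y (tree.run (x, ω.1) (y, ω.2)) := fun ω => h (x, ω.1) (y, ω.2)
  unfold PrivateCoinProtocol.prob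
  simp only [hall, Finset.filter_true]
  simpa using hδ

/-! ### Convergence of the two-party local search -/

/-- The iterates of a map that fixes a set or improves `φ` by a factor of more than `1 + c` reach a
fixed point within `t` steps if `φ` cannot grow by a factor of `(1 + c) ^ t`. -/
theorem isFixedPt_iterate_of_improves {Z : Type*} {φ : Z → ℝ} {c : ℝ} {step : Z → Z} {P : Z → Prop}
    (hc : 0 ≤ c) (hP : ∀ z, P z → P (step z))
    (himp : ∀ z, P z → step z = z ∨ (1 + c) * φ z < φ (step z)) {z : Z} (hz : P z) {t : ℕ}
    (ht : t ≠ 0) (hbound : ∀ w, P w → φ w ≤ (1 + c) ^ t * φ z) :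
    step (step^[t] z) = step^[t] z := by
  have hPt : ∀ t, P (step^[t] z) := by
    intro t
    induction t with
    | zero => exact hz
    | succ t ih => rw [Function.iterate_succ_apply']; exact hP _ ih
  have key : ∀ t, step (step^[t] z) = step^[t] z ∨
      (1 + c) ^ (t + 1) * φ z < φ (step^[t + 1] z) := by
    intro t
    induction t with
    | zero => simpa using himp z hz
    | succ t ih =>
      rcases ih with ih | ih
      · left
        rw [Function.iterate_succ_apply', ih, ih]
      · refine (himp _ (hPt (t + 1))).imp_right fun h => ?_
        rw [Function.iterate_succ_apply' _ (t + 1)]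
        refine lt_of_le_of_lt ?_ h
        rw [pow_succ' _ (t + 1), mul_assoc]
        gcongr
  obtain ⟨u, rfl⟩ := Nat.exists_eq_succ_of_ne_zero ht
  rcases key u with h | h
  · rw [Function.iterate_succ_apply', h, h]
  · exact absurd (hbound _ (hPt (u + 1))) (not_le.2 h)

section LocalSearch

variable {n : ℕ}

/-- A message of the local search: no move, the addition of an element `o`, or the exchange of an
element `s` for `o`. -/
abbrev Move (n : ℕ) : Type := Option (Fin n × Option (Fin n))

/-- The set that results from a move. -/
def Move.apply (S : Finset (Fin n)) : Move n → Finset (Fin n)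
  | none => S
  | some (o, none) => insert o S
  | some (o, some s) => insert o (S.erase s)

/-- A party with ground set `A` may propose the move at the set `S`: the new element, if any, is in
`A`, and the resulting set is feasible. -/
def Move.Available (K : PartitionConstraint n) (A S : Finset (Fin n)) (m : Move n) : Prop :=
  (∀ o t, m = some (o, t) → o ∈ A) ∧ K.Feasible (Move.apply S m)

/-- The available move `m` keeps `S` or improves `φ` by a factor of more than `1 + c`, and it is
best possible up to that factor. -/
def Move.IsGoodChoice (K : PartitionConstraint n) (φ : Finset (Fin n) → ℝ) (c : ℝ)
    (A S : Finset (Fin n)) (m : Move n) : Prop :=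
  m.Available K A S ∧ (Move.apply S m = S ∨ (1 + c) * φ S < φ (Move.apply S m)) ∧
    ∀ m' : Move n, m'.Available K A S → φ (Move.apply S m') ≤ (1 + c) * φ (Move.apply S m)

/-- A party can determine a best available move and make it only if it improves `φ` by a factor of
more than `1 + c`. -/
theorem exists_isGoodChoice {K : PartitionConstraint n} {φ : Finset (Fin n) → ℝ} {c : ℝ}
    (hc : 0 ≤ c) (hφ : ∀ S, 0 ≤ φ S) (A : Finset (Fin n)) {S : Finset (Fin n)}
    (hS : K.Feasible S) : ∃ m : Move n, m.IsGoodChoice K φ c A S := by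
  classical
  have hnone : Move.Available K A S (none : Move n) := ⟨by simp, hS⟩
  obtain ⟨m, hm, hmax⟩ := Finset.exists_max_image
    (Finset.univ.filter fun m : Move n => m.Available K A S) (fun m => φ (Move.apply S m))
    ⟨none, by simpa using hnone⟩
  simp only [Finset.mem_filter, Finset.mem_univ, true_and] at hm hmax
  by_cases h : (1 + c) * φ S < φ (Move.apply S m)
  · refine ⟨m, hm, Or.inr h, fun m' hm' => (hmax m' hm').trans ?_⟩
    nlinarith [hφ (Move.apply S m)]
  · exact ⟨none, hnone, Or.inl rfl, fun m' hm' => (hmax m' hm').trans (not_lt.1 h)⟩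

theorem Move.apply_empty (m : Move n) : Move.apply ∅ m = ∅ ∨ ∃ o, Move.apply ∅ m = {o} := by
  rcases m with _ | ⟨o, _ | s⟩
  · exact Or.inl rfl
  · exact Or.inr ⟨o, rfl⟩
  · exact Or.inr ⟨o, by simp [Move.apply]⟩

theorem Move.Available.apply_subset {K : PartitionConstraint n} {A S G : Finset (Fin n)}
    {m : Move n}
    (hm : m.Available K A S) (hA : A ⊆ G) (hS : S ⊆ G) : Move.apply S m ⊆ G := by
  rcases m with _ | ⟨o, _ | s⟩
  · exact hS
  · exact Finset.insert_subset (hA (hm.1 _ _ rfl)) hS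
  · exact Finset.insert_subset (hA (hm.1 _ _ rfl)) ((Finset.erase_subset _ _).trans hS)

variable {φ : Finset (Fin n) → ℝ} {c : ℝ} {K : PartitionConstraint n}

/-- One round consists of a move of Alice and a move of Bob, each a good
choice. After `t + 1` rounds from `∅` neither party has a move that improves `φ` by a factor of
more than `1 + c`. After the first round `φ` is within a constant factor of the best feasible
singleton, which by subadditivity leaves room for a factor of `1 + 4 * K.rank` only. -/
theorem localSearch_converges (hc : 0 ≤ c) (hc1 : c ≤ 1) (hφ : ∀ S, 0 ≤ φ S)
    (hsum : ∀ S, φ S ≤ φ ∅ + ∑ e ∈ S, φ {e}) {A B : Finset (Fin n)}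
    {mA mB : Finset (Fin n) → Move n}
    (hA : ∀ S, K.Feasible S → (mA S).IsGoodChoice K φ c A S)
    (hB : ∀ S, K.Feasible S → (mB S).IsGoodChoice K φ c B S)
    {t : ℕ} (ht : t ≠ 0) (hpow : 1 + 4 * (K.rank : ℝ) ≤ (1 + c) ^ t) {S : Finset (Fin n)}
    (hS : S = (fun T => Move.apply (Move.apply T (mA T)) (mB (Move.apply T (mA T))))^[t + 1] ∅) :
    S ⊆ A ∪ B ∧ K.Feasible S ∧
      (∀ m : Move n, m.Available K A S → φ (Move.apply S m) ≤ (1 + c) * φ S) ∧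
      ∀ m : Move n, m.Available K B S → φ (Move.apply S m) ≤ (1 + c) * φ S := by
  set half : Finset (Fin n) → Finset (Fin n) := fun T => Move.apply T (mA T) with hhalf
  set step : Finset (Fin n) → Finset (Fin n) := fun T =>
    Move.apply (Move.apply T (mA T)) (mB (Move.apply T (mA T))) with hstep
  let P : Finset (Fin n) → Prop := fun T => T ⊆ A ∪ B ∧ K.Feasible T
  have hPhalf : ∀ T, P T → P (half T) := fun T hT =>
    ⟨(hA T hT.2).1.apply_subset Finset.subset_union_left hT.1, (hA T hT.2).1.2⟩
  have hP : ∀ T, P T → P (step T) := fun T hT =>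
    ⟨(hB _ (hPhalf T hT).2).1.apply_subset Finset.subset_union_right (hPhalf T hT).1,
      (hB _ (hPhalf T hT).2).1.2⟩
  have hgrow : ∀ {x y : Finset (Fin n)}, (x = y ∨ (1 + c) * φ y < φ x) → φ y ≤ φ x := by
    rintro x y (rfl | h)
    · exact le_rfl
    · nlinarith [hφ y]
  have hle1 : ∀ T, P T → φ T ≤ φ (half T) := fun T hT => hgrow (hA T hT.2).2.1
  have hle2 : ∀ T, P T → φ (half T) ≤ φ (step T) := fun T hT =>
    hgrow (hB _ (hPhalf T hT).2).2.1
  have himp : ∀ T, P T → step T = T ∨ (1 + c) * φ T < φ (step T) := by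
    intro T hT
    rcases (hA T hT.2).2.1 with h | h
    · have h' := (hB _ (hPhalf T hT).2).2.1
      simp only [hstep, hhalf] at h' ⊢
      rwa [h] at h' ⊢
    · exact Or.inr (h.trans_le (hle2 T hT))
  have hP0 : P ∅ := ⟨Finset.empty_subset _, K.feasible_empty⟩
  have hempty : φ ∅ ≤ φ (step ∅) := (hle1 _ hP0).trans (hle2 _ hP0)
  have hsingle : ∀ e ∈ A ∪ B, K.Feasible {e} → φ {e} ≤ 2 * φ (step ∅) := by
    intro e he hfe
    have h2 : (1 + c) * φ (step ∅) ≤ 2 * φ (step ∅) := by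
      have := hφ (step ∅)
      gcongr
      linarith
    refine le_trans ?_ h2
    rcases Finset.mem_union.1 he with heA | heB
    · have h := (hA ∅ hP0.2).2.2 (some (e, none)) ⟨fun o t h => by
        obtain ⟨rfl, -⟩ : e = o ∧ none = t := by simpa using h
        exact heA, hfe⟩
      refine (h : φ {e} ≤ _).trans ?_
      have := hle2 _ hP0
      gcongr
    · obtain ⟨m, hmav, hm⟩ : ∃ m : Move n, m.Available K B (half ∅) ∧
          Move.apply (half ∅) m = {e} := by
        have hmem : ∀ (s t : Option (Fin n)) o, (some (e, s) : Move n) = some (o, t) → o ∈ B := by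
          intro s t o h
          obtain ⟨rfl, -⟩ : e = o ∧ s = t := by simpa using h
          exact heB
        rcases Move.apply_empty (mA ∅) with h | ⟨a, h⟩
        · have he' : Move.apply (half ∅) (some (e, none)) = {e} := by
            rw [show half ∅ = _ from h]
            simp [Move.apply]
          exact ⟨some (e, none), ⟨fun o t => hmem _ t o, he' ▸ hfe⟩, he'⟩
        · have he' : Move.apply (half ∅) (some (e, some a)) = {e} := by
            rw [show half ∅ = _ from h]
            simp [Move.apply]
          exact ⟨some (e, some a), ⟨fun o t => hmem _ t o, he' ▸ hfe⟩, he'⟩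
      have h := (hB _ (hPhalf _ hP0).2).2.2 m hmav
      rwa [hm] at h
  have hbound : ∀ T, P T → φ T ≤ (1 + c) ^ t * φ (step ∅) := by
    intro T hT
    have h1 : ∑ e ∈ T, φ {e} ≤ T.card • (2 * φ (step ∅)) :=
      Finset.sum_le_card_nsmul _ _ _ fun e he =>
        hsingle e (hT.1 he) (hT.2.mono (Finset.singleton_subset_iff.2 he))
    have h2 : (T.card : ℝ) ≤ K.rank := by exact_mod_cast hT.2.card_le_rank
    have h0 := hφ (step ∅)
    rw [nsmul_eq_mul] at h1
    calc φ T ≤ φ (step ∅) + T.card * (2 * φ (step ∅)) := by linarith [hsum T]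
      _ ≤ φ (step ∅) + K.rank * (2 * φ (step ∅)) := by gcongr
      _ ≤ (1 + 4 * (K.rank : ℝ)) * φ (step ∅) := by
        have : 0 ≤ (K.rank : ℝ) * φ (step ∅) := by positivity
        linarith
      _ ≤ _ := by gcongr
  have hfix := isFixedPt_iterate_of_improves hc hP himp (hP _ hP0) ht hbound
  rw [← Function.iterate_succ_apply, ← hS] at hfix
  have hPS : P S := by
    rw [hS]
    exact Function.Iterate.rec P hP0 hP (t + 1)
  have hfixA : half S = S := by
    rcases (hA S hPS.2).2.1 with h | h
    · exact h
    · have h' := hle2 S hPS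
      rw [hfix] at h'
      nlinarith [hφ S]
  refine ⟨hPS.1, hPS.2, fun m hm => ?_, fun m hm => ?_⟩
  · have h := (hA S hPS.2).2.2 m hm
    rwa [show Move.apply S (mA S) = S from hfixA] at h
  · have hfixB : Move.apply S (mB S) = S := by
      have : Move.apply (half S) (mB (half S)) = S := hfix
      rwa [hfixA] at this
    have h := (hB S hPS.2).2.2 m hm
    rwa [hfixB] at h

end LocalSearch

/-! ### Numerical estimates -/

theorem exp_sub_one_le {δ : ℝ} (hδ : 0 ≤ δ) (hδ1 : δ ≤ 1) :
    Real.exp (δ - 1) ≤ 1 / Real.exp 1 + δ := by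
  have h1 : 1 / Real.exp 1 = Real.exp (δ - 1) * Real.exp (-δ) := by
    rw [← Real.exp_add, one_div, ← Real.exp_neg]
    ring_nf
  have h2 : Real.exp (δ - 1) ≤ 1 := Real.exp_le_one_iff.2 (by linarith)
  have h3 := Real.add_one_le_exp (-δ)
  have h4 := Real.exp_pos (δ - 1)
  rw [h1]
  nlinarith

theorem le_one_add_pow {c x : ℝ} (hc : 0 < c) (hc1 : c ≤ 1) (hx : 0 < x) {t : ℕ}
    (ht : 2 / c * Real.log x ≤ t) : x ≤ (1 + c) ^ t := by
  have h1 : c / 2 ≤ Real.log (1 + c) := by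
    refine le_trans ?_ (Real.le_log_one_add_of_nonneg hc.le)
    rw [div_le_div_iff₀ (by norm_num) (by linarith)]
    nlinarith
  rw [← Real.log_le_log_iff hx (by positivity), Real.log_pow]
  calc Real.log x = 2 / c * Real.log x * (c / 2) := by field_simp
    _ ≤ t * (c / 2) := by gcongr
    _ ≤ t * Real.log (1 + c) := by gcongr

theorem clog_card_move_le {n : ℕ} (hn : 1 ≤ n) :
    (Nat.clog 2 (Fintype.card (Move n)) : ℝ) ≤ 5 + 4 * Real.log n := by
  have hcard : Fintype.card (Move n) = n * (n + 1) + 1 := by simp [Move]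
  have hn' : (1 : ℝ) ≤ n := by exact_mod_cast hn
  set k := Nat.clog 2 (Fintype.card (Move n))
  have h1 : 2 ^ k.pred < Fintype.card (Move n) :=
    Nat.pow_pred_clog_lt_self (by norm_num) (by rw [hcard]; nlinarith)
  have h2 : (2 : ℝ) ^ k.pred ≤ 3 * (n : ℝ) ^ 2 := by
    have : (2 : ℝ) ^ k.pred < n * (n + 1) + 1 := by rw [hcard] at h1; exact_mod_cast h1
    nlinarith
  have h3 : k.pred * Real.log 2 ≤ Real.log 3 + 2 * Real.log n := by
    have := Real.log_le_log (by positivity) h2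
    rw [Real.log_mul (by norm_num) (by positivity), Real.log_pow, Real.log_pow] at this
    exact_mod_cast this
  have h4 : Real.log 3 ≤ 2 := by
    linarith [Real.log_le_sub_one_of_pos (show (0 : ℝ) < 3 by norm_num)]
  have h5 : (k : ℝ) ≤ k.pred + 1 := by
    exact_mod_cast (Nat.sub_le_iff_le_add.1 le_rfl : k ≤ k.pred + 1)
  have h6 := Real.log_two_gt_d9
  have h7 : (0 : ℝ) ≤ k.pred := by positivity
  nlinarith

/-! ### The protocol -/

section

variable {n : ℕ} {f : Finset (Fin n) → ℝ} {K : PartitionConstraint n} {ε : ℝ}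

/-- A protocol without coins that simulates the local search for the potential with cutoff `ε / 2`
and improvement factor `1 + ε ^ 2 / (4 * K.rank)`. -/
theorem exists_localSearch_protocol (hf : ∀ S, 0 ≤ f S) (hmono : Monotone f)
    (hsub : IsSubmodular f) (hε : 0 < ε) (hε1 : ε < 1) (hr : 1 ≤ K.rank) {t : ℕ}
    (ht : 8 * K.rank / ε ^ 2 * Real.log (1 + 4 * K.rank) ≤ t) (ht0 : t ≠ 0) :
    ∃ tree : ProtocolTree (Finset (Fin n) × (Fin 0 → Bool)) (Finset (Fin n) × (Fin 0 → Bool))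
        (Finset (Fin n)),
      (∀ x y, IsApproxSolution f K (1 - 1 / Real.exp 1 - ε) x.1 y.1 (tree.run x y)) ∧
      tree.cost ≤ (t + 1) * (2 * Nat.clog 2 (Fintype.card (Move n))) := by
  have hr' : (1 : ℝ) ≤ K.rank := by exact_mod_cast hr
  set δ : ℝ := ε / 2 with hδdef
  set c : ℝ := ε ^ 2 / (4 * K.rank) with hcdef
  have hδ : 0 < δ := by positivity
  have hδ1 : δ ≤ 1 := by linarith
  have hc : 0 < c := by positivity
  have hc1 : c ≤ 1 := by
    rw [hcdef, div_le_one (by positivity)]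
    nlinarith
  have hφ : ∀ S, 0 ≤ potential f δ S := fun S => potential_nonneg hδ hδ1 hf
  -- Infeasible states never occur; there the choice of the move is arbitrary.
  have hchoice : ∀ A S : Finset (Fin n), ∃ m : Move n,
      K.Feasible S → m.IsGoodChoice K (potential f δ) c A S := by
    intro A S
    by_cases hS : K.Feasible S
    · obtain ⟨m, hm⟩ := exists_isGoodChoice hc.le hφ A hS
      exact ⟨m, fun _ => hm⟩
    · exact ⟨none, fun h => absurd h hS⟩
  choose move hmove using hchoice
  set k := Nat.clog 2 (Fintype.card (Move n))
  obtain ⟨enc⟩ : Nonempty (Move n ↪ (Fin k → Bool)) :=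
    Function.Embedding.nonempty_of_card_le (by
      rw [Fintype.card_fun, Fintype.card_bool, Fintype.card_fin]
      exact Nat.le_pow_clog (by norm_num) _)
  let dec : (Fin k → Bool) → Move n := Function.invFun enc
  have hdec : ∀ m, dec (enc m) = m := Function.leftInverse_invFun enc.injective
  refine ⟨ProtocolTree.alternate (fun S x => enc (move x.1 S)) (fun S y => enc (move y.1 S))
    (fun S v => Move.apply S (dec v)) (t + 1) ∅, fun x y => ?_,
    ProtocolTree.cost_alternate_le _ _ _ _ _⟩
  rw [ProtocolTree.run_alternate]
  simp only [hdec]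
  obtain ⟨A, -⟩ := x
  obtain ⟨B, -⟩ := y
  have hpow : 1 + 4 * (K.rank : ℝ) ≤ (1 + c) ^ t := by
    refine le_one_add_pow hc hc1 (by positivity) (le_trans (le_of_eq ?_) ht)
    rw [hcdef]
    field_simp
    ring
  obtain ⟨hSAB, hS, hoptA, hoptB⟩ := localSearch_converges hc.le hc1 hφ
    (potential_le_sum_singleton hf hmono hsub hδ hδ1) (hmove A) (hmove B) ht0 hpow rfl
  set S := (fun T => Move.apply (Move.apply T (move A T))
    (move B (Move.apply T (move A T))))^[t + 1] ∅
  refine ⟨hSAB, hS, fun O hO hOf => ?_⟩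
  have hopt : ∀ o ∈ O, ∀ s : Option (Fin n), K.Feasible (Move.apply S (some (o, s))) →
      potential f δ (Move.apply S (some (o, s))) ≤
        potential f δ S + c * potential f δ S := by
    intro o ho s hfeas
    have hav : ∀ G : Finset (Fin n), o ∈ G → Move.Available K G S (some (o, s)) := by
      refine fun G hG => ⟨fun o' s' h => ?_, hfeas⟩
      obtain ⟨rfl, -⟩ : o = o' ∧ s = s' := by simpa using h
      exact hG
    rw [← one_add_mul]
    rcases Finset.mem_union.1 (hO ho) with h | h
    · exact hoptA _ (hav _ h)
    · exact hoptB _ (hav _ h)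
  have hval := hS.le_of_locallyOptimal hf hmono hsub hδ hδ1 hOf (mul_nonneg hc.le (hφ S))
    (fun o ho => hopt o ho none) (fun o ho s _ => hopt o ho (some s))
  have herr : (O.card : ℝ) * (c * potential f δ S) ≤ ε / 2 * f S := by
    have h1 : (O.card : ℝ) ≤ K.rank := by exact_mod_cast hOf.card_le_rank
    have h2 := potential_le (S := S) hδ hδ1 hf hmono
    have h3 := hf S
    calc (O.card : ℝ) * (c * potential f δ S) ≤ K.rank * (c * (f S / δ)) := by
          have := hφ S
          gcongr
      _ = ε / 2 * f S := by
          rw [hcdef, hδdef]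
          field_simp
          ring
  have hexp := exp_sub_one_le hδ.le hδ1
  have hfO := hf O
  have hinv : 0 < 1 / Real.exp 1 := by positivity
  rcases le_total (f O) (f S) with h | h
  · nlinarith
  · have h1 : ε / 2 * f S ≤ ε / 2 * f O := by gcongr
    have h2 : Real.exp (δ - 1) * f O ≤ (1 / Real.exp 1 + δ) * f O := by gcongr
    linarith [hδdef ▸ h2]

theorem privateCoinComplexity_eq_zero_of_rank_eq_zero (hf : ∀ S, 0 ≤ f S) (hε : 0 < ε)
    (hr : K.rank = 0) :
    privateCoinComplexity (IsApproxSolution f K (1 - 1 / Real.exp 1 - ε)) ε = 0 := by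
  refine le_antisymm ?_ bot_le
  refine (privateCoinComplexity_le_of_deterministic hε.le (ProtocolTree.output ∅)
    fun x y => ⟨Finset.empty_subset _, K.feasible_empty, fun S _ hS => ?_⟩).trans_eq rfl
  obtain rfl : S = ∅ := Finset.card_eq_zero.1 (Nat.le_zero.1 (hr ▸ hS.card_le_rank))
  have h1 := hf ∅
  have h2 : 0 < 1 / Real.exp 1 := by positivity
  rw [ProtocolTree.run]
  nlinarith

end

theorem mainTheorem6 :
    ∃ p : MvPolynomial (Fin 2) ℝ,
      ∀ (n : ℕ) (f : Finset (Fin n) → ℝ) (K : PartitionConstraint n) (ε : ℝ),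
        (∀ S, 0 ≤ f S) → Monotone f → IsSubmodular f → 0 < ε → ε < 1 →
        ((privateCoinComplexity (IsApproxSolution f K (1 - 1 / Real.exp 1 - ε)) ε : ℕ∞) : ENNReal) ≤
          ENNReal.ofReal ((K.rank : ℝ) * MvPolynomial.eval ![Real.log n, 1 / ε] p) := by
  refine ⟨(8 * MvPolynomial.X 1 ^ 2 * (4 + MvPolynomial.X 0) + 2) *
    (2 * (5 + 4 * MvPolynomial.X 0)), fun n f K ε hf hmono hsub hε hε1 => ?_⟩
  rcases Nat.eq_zero_or_pos K.rank with hr | hr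
  · rw [privateCoinComplexity_eq_zero_of_rank_eq_zero hf hε hr, ENat.toENNReal_zero]
    exact zero_le
  have hn : 1 ≤ n := (Nat.succ_le_of_lt hr).trans K.rank_le
  have hn' : (1 : ℝ) ≤ n := by exact_mod_cast hn
  have hr' : (1 : ℝ) ≤ K.rank := by exact_mod_cast hr
  have hlogn : 0 ≤ Real.log n := Real.log_nonneg hn'
  have hlogr : Real.log (1 + 4 * K.rank) ≤ 4 + Real.log n := by
    have h1 : (1 + 4 * K.rank : ℝ) ≤ 5 * n := by
      have : (K.rank : ℝ) ≤ n := by exact_mod_cast K.rank_le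
      linarith
    have h2 := Real.log_le_log (by positivity) h1
    rw [Real.log_mul (by norm_num) (by positivity)] at h2
    linarith [Real.log_le_sub_one_of_pos (show (0 : ℝ) < 5 by norm_num)]
  have hlogr0 : 0 < Real.log (1 + 4 * K.rank) := Real.log_pos (by linarith)
  set t := ⌈8 * K.rank / ε ^ 2 * Real.log (1 + 4 * K.rank)⌉₊
  obtain ⟨tree, hsolves, hcost⟩ := exists_localSearch_protocol hf hmono hsub hε hε1 hr
    (Nat.le_ceil (8 * K.rank / ε ^ 2 * Real.log (1 + 4 * K.rank)))
    (Nat.ceil_pos.2 (by positivity)).ne'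
  have hle := privateCoinComplexity_le_of_deterministic hε.le tree hsolves
  have hle' : ((privateCoinComplexity (IsApproxSolution f K (1 - 1 / Real.exp 1 - ε)) ε : ℕ∞) :
      ENNReal) ≤ ((tree.cost : ℕ∞) : ENNReal) := ENat.toENNReal_le.2 hle
  refine hle'.trans ?_
  rw [ENat.toENNReal_coe, ← ENNReal.ofReal_natCast]
  refine ENNReal.ofReal_le_ofReal ?_
  have ht : (t : ℝ) + 1 ≤ K.rank * (8 * (1 / ε) ^ 2 * (4 + Real.log n) + 2) := by
    have h1 : (t : ℝ) ≤ 8 * K.rank / ε ^ 2 * Real.log (1 + 4 * K.rank) + 1 :=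
      (Nat.ceil_lt_add_one (by positivity)).le
    have h2 : 8 * K.rank / ε ^ 2 * Real.log (1 + 4 * K.rank) ≤
        8 * K.rank / ε ^ 2 * (4 + Real.log n) := by gcongr
    have h3 : 8 * K.rank / ε ^ 2 * (4 + Real.log n) =
        K.rank * (8 * (1 / ε) ^ 2 * (4 + Real.log n)) := by
      field_simp
    linarith
  have hcost' : (tree.cost : ℝ) ≤
      ((t : ℝ) + 1) * (2 * Nat.clog 2 (Fintype.card (Move n))) := by
    have h : (tree.cost : ℝ) ≤ ((t + 1) * (2 * Nat.clog 2 (Fintype.card (Move n))) : ℕ) :=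
      Nat.cast_le.2 hcost
    rwa [Nat.cast_mul, Nat.cast_mul, Nat.cast_add, Nat.cast_one, Nat.cast_ofNat] at h
  have hk := clog_card_move_le hn
  calc (tree.cost : ℝ) ≤ ((t : ℝ) + 1) * (2 * Nat.clog 2 (Fintype.card (Move n))) := hcost'
    _ ≤ K.rank * (8 * (1 / ε) ^ 2 * (4 + Real.log n) + 2) * (2 * (5 + 4 * Real.log n)) := by
        gcongr
    _ = _ := by
        simp
        ring
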